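/- Let $N,d\ge 1$ and let $\Omega\subseteq\mathbb R^N$ be a bounded open set (no regularity of $\partial\Omega$ is assumed). Let $f:\Omega\times\mathbb R^d\times\mathbb R^{Nd}\to\mathbb R$ be a normal integrand, i.e. $f$ is $\mathcal L^N\otimes\mathcal B_d\otimes\mathcal B_{Nd}$-measurable (Lebesgue measurable sets in the first variable, Borel sets in the others) and $f(x,\cdot,\cdot)$ is lower semicontinuous for a.e. $x\in\Omega$. Assume: (H1) for a.e. $x\in\Omega$ and every $u\in\mathbb R^d$, the function $f(x,u,\cdot)$ is level convex, i.e. $\{\xi: f(x,u,\xi)\le t\}$ is convex for every $t\in\mathbb R$; (H2) there exist $\alpha,\gamma>0$ such that $f(x,u,\xi)\ge\alpha|\xi|^\gamma$ for a.e. $x\in\Omega$ and every $(u,\xi)\in\mathbb R^d\times\mathbb R^{Nd}$. Let $p_n:\Omega\to(1,\infty)$ be Lebesgue measurable functions, put $p_n^-=\operatorname{ess\,inf}_\Omega p_n$ and $p_n^+=\operatorname{ess\,sup}_\Omega p_n$, and assume that $p_n^-\to+\infty$ as $n\to\infty$ and that there is $\beta>1$ with $p_n^+\le\beta\,p_n^-$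 for all $n$. For measurable $v:\Omega\to\mathbb R$ let $$\|v\|_{p_n(\cdot)}=\inf\Big\{\lambda>0:\int_\Omega\Big|\frac{v(x)}{\lambda}\Big|^{p_n(x)}dx\le 1\Big\}\in[0,+\infty]$$ be the Luxemburg norm ($\inf\emptyset=+\infty$), and let $W^{1,p_n(\cdot)}(\Omega,\mathbb R^d)$ be the space of those $u$ that have a weak gradient $Du$ with $\int_\Omega|u|^{p_n(x)}dx<\infty$ and $\int_\Omega|Du|^{p_n(x)}dx<\infty$. Let $X$ be either $L^\infty(\Omega,\mathbb R^d)$ or the space $C(\Omega,\mathbb R^d)$ of bounded continuous functions $\Omega\to\mathbb R^d$, endowed with the norm $\|\cdot\|_\infty$. Define $F_n,F:X\to[0,+\infty]$ by $$F_n(u)=\begin{cases}\|f(\cdot,u(\cdot),Du(\cdot))\|_{p_n(\cdot)}&\text{if }u\in W^{1,p_n(\cdot)}(\Omega,\mathbb R^d),\\+\infty&\text{otherwise,}\end{cases}\qquad F(u)=\begin{cases}\operatorname{ess\,sup}_{x\in\Omega}f(x,u(x),Du(x))&\text{if }u\in W^{1,\infty}(\Omega,\mathbb R^d),\\+\infty&\text{otherwise.}\end{cases}$$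 Then: (i) for every $u\in X$ and every sequence $(u_n)\subset X$ with $u_n\to u$ in $X$, one has $F(u)\le\liminf_{n\to\infty}F_n(u_n)$; (ii) for every $u\in X$ there exists a sequence $(u_n)\subset X$ with $u_n\to u$ in $X$ and $\limsup_{n\to\infty}F_n(u_n)\le F(u)$. In particular, $(F_n)$ $\Gamma$-converges to $F$ as $n\to\infty$ with respect to the strong topology of $X$, i.e. (i) holds and every $u\in X$ is the limit in $X$ of a sequence $(u_n)\subset X$ with $\lim_{n\to\infty}F_n(u_n)=F(u)$. -/

import Mathlib

open MeasureTheory Filter Topology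
open scoped ENNReal BoundedContinuousFunction

attribute [local instance] Measure.Subtype.measureSpace

noncomputable section

/-- `ℝ^N` with the Euclidean norm. -/
abbrev RVec (N : ℕ) : Type := EuclideanSpace ℝ (Fin N)

/-- `ℝ^{Nd}`: the `d × N` real matrices with the Euclidean (Frobenius) norm. The entry `(j, i)` of a
gradient is `∂ u_j / ∂ x_i`. -/
abbrev RMat (d N : ℕ) : Type := EuclideanSpace ℝ (Fin d × Fin N)

/-! An open set `Ω ⊆ ℝ^N` is used as the subtype `↥Ω`, and `volume` on it is the restriction of the
Lebesgue measure. All functions "on `Ω`" are functions on this subtype. -/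

/-- Test functions on `Ω`: the smooth functions with compact support contained in `Ω`. -/
def IsTestFunction {N : ℕ} (Ω : Set (RVec N)) (φ : RVec N → ℝ) : Prop :=
  ContDiff ℝ ((⊤ : ℕ∞) : WithTop ℕ∞) φ ∧ HasCompactSupport φ ∧ tsupport φ ⊆ Ω

/-- `U` is a weak (distributional) gradient of `u` on `Ω`: both belong to `L¹_loc(Ω)` and
`∫_Ω u_j ∂_i φ = - ∫_Ω U_{ji} φ` for all test functions `φ` and all `i`, `j`. -/
def HasWeakGradient {N d : ℕ} (Ω : Set (RVec N)) (u : Ω → RVec d) (U : Ω → RMat d N) : Prop :=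
  LocallyIntegrable u volume ∧ LocallyIntegrable U volume ∧
    ∀ φ : RVec N → ℝ, IsTestFunction Ω φ → ∀ (j : Fin d) (i : Fin N),
      ∫ x : Ω, u x j * fderiv ℝ φ x (EuclideanSpace.single i 1) = - ∫ x : Ω, U x (j, i) * φ x

/-- `u` has a weak gradient on `Ω`. -/
def WeaklyDifferentiable {N d : ℕ} (Ω : Set (RVec N)) (u : Ω → RVec d) : Prop :=
  ∃ U : Ω → RMat d N, HasWeakGradient Ω u U

open Classical in
/-- The weak gradient `Du` (unique up to a null set, see `HasWeakGradient.ae_eq`); by convention `0`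
if `u` has none. -/
def weakGrad {N d : ℕ} (Ω : Set (RVec N)) (u : Ω → RVec d) : Ω → RMat d N :=
  if h : WeaklyDifferentiable Ω u then h.choose else 0

theorem WeaklyDifferentiable.hasWeakGradient {N d : ℕ} {Ω : Set (RVec N)} {u : Ω → RVec d}
    (h : WeaklyDifferentiable Ω u) : HasWeakGradient Ω u (weakGrad Ω u) := by
  unfold weakGrad
  rw [dif_pos h]
  exact h.choose_spec

/-- Weak gradients on an open set are unique up to null sets. -/
theorem HasWeakGradient.ae_eq {N d : ℕ} {Ω : Set (RVec N)} (hΩ : IsOpen Ω) {u : Ω → RVec d}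
    {U V : Ω → RMat d N} (hU : HasWeakGradient Ω u U) (hV : HasWeakGradient Ω u V) :
    U =ᵐ[volume] V := by
  have hm : MeasurableSet Ω := hΩ.measurableSet
  have hemb : MeasurableEmbedding ((↑) : Ω → RVec N) := MeasurableEmbedding.subtype_coe hm
  have key : ∀ k : Fin d × Fin N, ∀ᵐ x : Ω, U x k = V x k := by
    rintro ⟨j, i⟩
    have coord : ∀ W : Ω → RMat d N, LocallyIntegrable W volume →
        LocallyIntegrable (fun x => W x (j, i)) volume := by
      intro W hW x
      obtain ⟨s, hs, hi⟩ := hW x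
      refine ⟨s, hs, ?_⟩
      exact (EuclideanSpace.proj (j, i) : RMat d N →L[ℝ] ℝ).integrable_comp hi
    have hUk := coord U hU.2.1
    have hVk := coord V hV.2.1
    set g : Ω → ℝ := fun x => U x (j, i) - V x (j, i) with hg
    have hgl : LocallyIntegrable g volume := hUk.sub hVk
    set F : RVec N → ℝ := Function.extend ((↑) : Ω → RVec N) g 0 with hF
    have hFg : ∀ x : Ω, F x = g x := fun x => Subtype.val_injective.extend_apply g 0 x
    have hFl : LocallyIntegrableOn F Ω volume := by
      intro x hx
      obtain ⟨s, hs, hi⟩ := hgl ⟨x, hx⟩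
      refine ⟨(↑) '' s, mem_nhdsWithin_of_mem_nhds (hΩ.isOpenMap_subtype_val.image_mem_nhds hs), ?_⟩
      rw [hemb.integrableOn_iff_comap (by rintro _ ⟨y, -, rfl⟩; exact ⟨y, rfl⟩),
        Set.preimage_image_eq _ Subtype.val_injective]
      have : F ∘ ((↑) : Ω → RVec N) = g := funext hFg
      rw [this]
      exact hi
    have h0 : ∀ᵐ x : RVec N, x ∈ Ω → F x = 0 := by
      refine hΩ.ae_eq_zero_of_integral_contDiff_smul_eq_zero hFl ?_
      intro φ hφ hc hs
      have hU' := hU.2.2 φ ⟨hφ, hc, hs⟩ j i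
      have hV' := hV.2.2 φ ⟨hφ, hc, hs⟩ j i
      have hcs : HasCompactSupport (fun x : Ω => φ x) := by
        refine HasCompactSupport.intro
          (Topology.IsInducing.subtypeVal.isCompact_preimage'
            hc (by simpa using hs)) ?_
        intro x hx
        exact image_eq_zero_of_notMem_tsupport hx
      have hcont : Continuous (fun x : Ω => φ x) := hφ.continuous.comp continuous_subtype_val
      have hUi : Integrable (fun x : Ω => U x (j, i) * φ x) volume :=
        hUk.integrable_smul_right_of_hasCompactSupport hcont hcs
      have hVi : Integrable (fun x : Ω => V x (j, i) * φ x) volume :=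
        hVk.integrable_smul_right_of_hasCompactSupport hcont hcs
      have h1 : ∫ x : Ω, φ x • F x = 0 := by
        have h2 : ∀ x : Ω, φ x • F x = U x (j, i) * φ x - V x (j, i) * φ x := by
          intro x
          rw [hFg, hg, smul_eq_mul]
          ring
        simp_rw [h2]
        rw [integral_sub hUi hVi]
        linarith
      rw [← setIntegral_eq_integral_of_forall_compl_eq_zero (s := Ω), ← integral_subtype_comap hm]
      · exact h1
      · intro x hx
        rw [image_eq_zero_of_notMem_tsupport (fun h => hx (hs h)), zero_smul]
    have h3 := (ae_restrict_iff_subtype (μ := volume) hm).1 ((ae_restrict_iff' hm).2 h0)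
    filter_upwards [h3] with x hx
    rw [hFg] at hx
    exact sub_eq_zero.1 hx
  filter_upwards [ae_all_iff.2 key] with x hx
  ext k
  exact hx k

/-- `v ∈ L^{p(·)}(Ω, E)` for a (bounded) variable exponent `p`: `v` is measurable and
`∫_Ω |v(x)|^{p(x)} dx < ∞`. -/
def MemLpVar {N : ℕ} {E : Type*} [NormedAddCommGroup E] (Ω : Set (RVec N)) (p : Ω → ℝ)
    (v : Ω → E) : Prop :=
  AEStronglyMeasurable v volume ∧ ∫⁻ x : Ω, ‖v x‖ₑ ^ p x < ∞

/-- The Luxemburg norm `inf {t > 0 : ∫_Ω |v(x) / t|^{p(x)} dx ≤ 1}`, with value `∞` if there is no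
such `t`. -/
def luxemburgNorm {N : ℕ} (Ω : Set (RVec N)) (p : Ω → ℝ) (v : Ω → ℝ) : ℝ≥0∞ :=
  ⨅ (t : ℝ) (_ : 0 < t ∧ ∫⁻ x : Ω, ‖v x / t‖ₑ ^ p x ≤ 1), ENNReal.ofReal t

/-- `u ∈ W^{1,p(·)}(Ω, ℝ^d)`. -/
def MemW1pVar {N d : ℕ} (Ω : Set (RVec N)) (p : Ω → ℝ) (u : Ω → RVec d) : Prop :=
  WeaklyDifferentiable Ω u ∧ MemLpVar Ω p u ∧ MemLpVar Ω p (weakGrad Ω u)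

/-- `u ∈ W^{1,∞}(Ω, ℝ^d)`. -/
def MemW1Infty {N d : ℕ} (Ω : Set (RVec N)) (u : Ω → RVec d) : Prop :=
  WeaklyDifferentiable Ω u ∧ MemLp u ∞ volume ∧ MemLp (weakGrad Ω u) ∞ volume

/-- `p⁻ = ess inf_Ω p`, for a positive function `p`. -/
def exponentInf {N : ℕ} (Ω : Set (RVec N)) (p : Ω → ℝ) : ℝ≥0∞ :=
  essInf (fun x => ENNReal.ofReal (p x)) volume

/-- `p⁺ = ess sup_Ω p`, for a positive function `p`. -/
def exponentSup {N : ℕ} (Ω : Set (RVec N)) (p : Ω → ℝ) : ℝ≥0∞ :=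
  essSup (fun x => ENNReal.ofReal (p x)) volume

/-- `f : Ω × ℝ^d × ℝ^{Nd} → ℝ` is a normal integrand. The σ-algebra of
`NullMeasurableSpace Ω volume` is that of the Lebesgue measurable subsets of `Ω`. -/
structure IsNormalIntegrand {N d : ℕ} (Ω : Set (RVec N)) (f : Ω → RVec d → RMat d N → ℝ) :
    Prop where
  measurable : Measurable
    (fun z : NullMeasurableSpace Ω (volume : Measure Ω) × RVec d × RMat d N => f z.1 z.2.1 z.2.2)
  lowerSemicontinuous : ∀ᵐ x : Ω, LowerSemicontinuous (fun z : RVec d × RMat d N => f x z.1 z.2)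

/-- A real function is level convex if all its sublevel sets are convex. -/
def LevelConvex {E : Type*} [AddCommGroup E] [Module ℝ E] (g : E → ℝ) : Prop :=
  ∀ t : ℝ, Convex ℝ {ξ : E | g ξ ≤ t}

open Classical in
/-- `‖f(·, u, Du)‖_{p(·)}` if `u ∈ W^{1,p(·)}(Ω, ℝ^d)`, and `+∞` otherwise. -/
def powerFunctional {N d : ℕ} (Ω : Set (RVec N)) (f : Ω → RVec d → RMat d N → ℝ) (p : Ω → ℝ)
    (u : Ω → RVec d) : ℝ≥0∞ :=
  if MemW1pVar Ω p u then luxemburgNorm Ω p (fun x => f x (u x) (weakGrad Ω u x)) else ∞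

open Classical in
/-- `ess sup_Ω f(x, u(x), Du(x))` if `u ∈ W^{1,∞}(Ω, ℝ^d)`, and `+∞` otherwise; the essential supremum
is taken in `[0, ∞]`, the integrand `f` being nonnegative. -/
def supremalFunctional {N d : ℕ} (Ω : Set (RVec N)) (f : Ω → RVec d → RMat d N → ℝ)
    (u : Ω → RVec d) : ℝ≥0∞ :=
  if MemW1Infty Ω u then essSup (fun x => ENNReal.ofReal (f x (u x) (weakGrad Ω u x))) volume
  else ∞

/-- `Φ n` `Γ`-converges to `Φ₀` on the metric space `X` (sequential form): the liminf inequality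
along all convergent sequences, and existence of recovery sequences. -/
def GammaConverges {X : Type*} [MetricSpace X] (Φ : ℕ → X → ℝ≥0∞) (Φ₀ : X → ℝ≥0∞) : Prop :=
  (∀ (x : X) (y : ℕ → X), Tendsto y atTop (𝓝 x) →
      Φ₀ x ≤ liminf (fun n => Φ n (y n)) atTop) ∧
    ∀ x : X, ∃ y : ℕ → X, Tendsto y atTop (𝓝 x) ∧
      Tendsto (fun n => Φ n (y n)) atTop (𝓝 (Φ₀ x))

end

/-! The upper bound needs only constant sequences. If `M` is the finite essential supremum of `f(x,
u, Du)` and `t > M`, the modular at level `t` is at most `(M/t)^K |Ω|` once `p_n ≥ K` a.e., so the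
Luxemburg norm is eventually at most `t`. The ratio bound on the exponents makes each `p_n`
essentially bounded, whence `W^{1,∞} ⊆ W^{1,p_n(·)}`.

For the lower bound, take `t < t'` with `t` above the liminf and a subsequence of energies below
`t`. Coercivity bounds the gradients in `L²`, so convex combinations of their tails converge
strongly, and a.e. along a subsequence, to `Du` (`exists_hasWeakGradient_of_bounded`). By Chebyshev,
`{f(x, w_k, Dw_k) > t'}` has measure at most `2^{-k}` (`eventually_volume_lt_le`); by
Borel–Cantelli, a.e. `x` satisfies `f(x, w_k(x), Dw_k(x)) ≤ t'` for all large `k`. At such an `x`,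
lower semicontinuity and coercivity push the gradients towards the closed convex set `{f(x, u(x), ·)
≤ t'}`, which therefore contains the limit of their convex combinations
(`le_of_tendsto_mem_convexHull_tail`). Hence `f(x, u, Du) ≤ t'` a.e. -/

/-- A bounded sequence in a Hilbert space has convex combinations of its tails that converge
strongly. -/
theorem exists_tendsto_mem_convexHull_tail {H : Type*} [NormedAddCommGroup H]
    [InnerProductSpace ℝ H] [CompleteSpace H] (x : ℕ → H) (C : ℝ) (hC : ∀ n, ‖x n‖ ≤ C) :
    ∃ (z : H) (y : ℕ → H), (∀ m, y m ∈ convexHull ℝ (x '' Set.Ici m)) ∧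
      Tendsto y atTop (𝓝 z) := by
  set K : ℕ → Set H := fun m => closure (convexHull ℝ (x '' Set.Ici m)) with hK
  have hconv : ∀ m, Convex ℝ (K m) := fun m => (convex_convexHull ℝ _).closure
  have hanti : ∀ m n, m ≤ n → K n ⊆ K m := fun m n h =>
    closure_mono (convexHull_mono (Set.image_mono (Set.Ici_subset_Ici.2 h)))
  have hne : ∀ m, (K m).Nonempty := fun m =>
    ⟨x m, subset_closure (subset_convexHull ℝ _ ⟨m, Set.self_mem_Ici, rfl⟩)⟩
  -- Points `v m` of least norm in the decreasing sets `K m` have increasing norms bounded by `C`.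
  -- Midpoints of `v m` and `v n` stay in `K m`, so the parallelogram law makes `v` Cauchy.
  have hex : ∀ m, ∃ v ∈ K m, ∀ w ∈ K m, ‖v‖ ≤ ‖w‖ := by
    intro m
    obtain ⟨v, hv, hmin⟩ := exists_norm_eq_iInf_of_complete_convex (hne m)
      isClosed_closure.isComplete (hconv m) 0
    refine ⟨v, hv, fun w hw => ?_⟩
    have h := ciInf_le (f := fun w : K m => ‖(0 : H) - w‖)
      ⟨0, by rintro _ ⟨w, rfl⟩; exact norm_nonneg _⟩ ⟨w, hw⟩
    rw [← hmin] at h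
    simpa using h
  choose v hv hmin using hex
  have hmono : Monotone fun m => ‖v m‖ ^ 2 := fun m n h =>
    pow_le_pow_left₀ (norm_nonneg _) (hmin m _ (hanti m n h (hv n))) 2
  have hbdd : BddAbove (Set.range fun m => ‖v m‖ ^ 2) := by
    refine ⟨C ^ 2, ?_⟩
    rintro _ ⟨m, rfl⟩
    refine pow_le_pow_left₀ (norm_nonneg _) ((hmin m (x m) ?_).trans (hC m)) 2
    exact subset_closure (subset_convexHull ℝ _ ⟨m, Set.self_mem_Ici, rfl⟩)
  have hlim := tendsto_atTop_ciSup hmono hbdd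
  set ℓ := ⨆ m, ‖v m‖ ^ 2
  have hdist : ∀ m n, m ≤ n → ‖v m - v n‖ ^ 2 ≤ 2 * (ℓ - ‖v m‖ ^ 2) := by
    intro m n h
    have hmid : (1 / 2 : ℝ) • v m + (1 / 2 : ℝ) • v n ∈ K m :=
      hconv m (hv m) (hanti m n h (hv n)) (by norm_num) (by norm_num) (by norm_num)
    have h1 := hmin m _ hmid
    rw [← smul_add, norm_smul] at h1
    norm_num at h1
    have h2 := parallelogram_law_with_norm ℝ (v m) (v n)
    have h3 : ‖v n‖ ^ 2 ≤ ℓ := le_ciSup hbdd n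
    nlinarith [norm_nonneg (v m)]
  have hcauchy : CauchySeq v := by
    rw [Metric.cauchySeq_iff']
    intro ε hε
    have h1 : ∀ᶠ m in atTop, ℓ - ε ^ 2 / 2 < ‖v m‖ ^ 2 :=
      hlim.eventually (lt_mem_nhds (by have := pow_pos hε 2; linarith))
    obtain ⟨m, hm⟩ := h1.exists
    refine ⟨m, fun n hn => ?_⟩
    rw [dist_comm, dist_eq_norm]
    have := hdist m n hn
    exact lt_of_pow_lt_pow_left₀ 2 hε.le (by linarith)
  obtain ⟨z, hz⟩ := cauchySeq_tendsto_of_complete hcauchy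
  have hy : ∀ m : ℕ, ∃ y ∈ convexHull ℝ (x '' Set.Ici m), dist (v m) y < 1 / ((m : ℝ) + 1) :=
    fun m => Metric.mem_closure_iff.1 (hv m) _ (by positivity)
  choose y hy hyd using hy
  refine ⟨z, y, hy, hz.congr_dist ?_⟩
  exact squeeze_zero (fun _ => dist_nonneg) (fun m => (hyd m).le)
    tendsto_one_div_add_atTop_nhds_zero_nat

/-- Lower semicontinuity of level convex coercive functions along convex combinations of tails. -/
theorem le_of_tendsto_mem_convexHull_tail {A B : Type*} [NormedAddCommGroup A]
    [NormedAddCommGroup B] [NormedSpace ℝ B] [ProperSpace B] {g : A → B → ℝ}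
    (hg : LowerSemicontinuous fun z : A × B => g z.1 z.2) {t R : ℝ} {a : ℕ → A} {a₀ : A}
    (hconv : Convex ℝ {ξ | g a₀ ξ ≤ t}) (hR : ∀ a ξ, g a ξ ≤ t → ‖ξ‖ ≤ R)
    (ha : Tendsto a atTop (𝓝 a₀)) {b : ℕ → B} (hb : ∀ᶠ k in atTop, g (a k) (b k) ≤ t)
    {y : ℕ → B} {z : B} (hy : ∃ᶠ m in atTop, y m ∈ convexHull ℝ (b '' Set.Ici m))
    (hz : Tendsto y atTop (𝓝 z)) : g a₀ z ≤ t := by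
  have hT : IsClosed {q : A × B | g q.1 q.2 ≤ t} := hg.isClosed_preimage t
  set S : Set B := {ξ | g a₀ ξ ≤ t} with hS
  have hSc : IsClosed S := hT.preimage (f := fun ξ : B => (a₀, ξ)) (by fun_prop)
  suffices z ∈ closure S by rwa [hSc.closure_eq] at this
  -- Otherwise infinitely many `b k` stay `ε`-far from `S`. They are bounded by `R`, so a
  -- subsequence converges, and closedness of the joint sublevel set puts its limit in `S`.
  have hnear : ∀ ε > 0, ∀ᶠ k in atTop, b k ∈ Metric.thickening ε S := by
    intro ε hε
    by_contra hcon
    have hfr := (not_eventually.1 hcon).and_eventually hb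
    obtain ⟨φ, hφ, hP⟩ := extraction_of_frequently_atTop hfr
    obtain ⟨β, -, ψ, hψ, hlim⟩ := (isCompact_closedBall (0 : B) R).tendsto_subseq
      (x := b ∘ φ) (fun k => mem_closedBall_zero_iff.2 (hR _ _ (hP k).2))
    have hβ : (a₀, β) ∈ {q : A × B | g q.1 q.2 ≤ t} := by
      refine hT.mem_of_tendsto
        ((ha.comp ((hφ.comp hψ).tendsto_atTop)).prodMk_nhds hlim) ?_
      exact Eventually.of_forall fun k => (hP (ψ k)).2
    have hev := hlim.eventually (Metric.isOpen_thickening.mem_nhds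
      (Metric.self_subset_thickening hε S hβ))
    obtain ⟨k, hk⟩ := hev.exists
    exact (hP (ψ k)).1 hk
  rw [Metric.closure_eq_iInter_cthickening, Set.mem_iInter₂]
  intro ε hε
  refine Metric.closure_thickening_subset_cthickening ε S ?_
  refine mem_closure_of_frequently_of_tendsto ?_ hz
  obtain ⟨M, hM⟩ := eventually_atTop.1 (hnear ε hε)
  refine (hy.and_eventually (eventually_ge_atTop M)).mono ?_
  rintro m ⟨hm, hMm⟩
  refine convexHull_min ?_ (hconv.thickening ε) hm
  rintro _ ⟨k, hk, rfl⟩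
  exact hM k (hMm.trans hk)

/-! ### Weak gradients: linearity and passage to the limit -/

theorem LocallyIntegrable.euclidean_apply {X ι : Type*} [Fintype ι] [TopologicalSpace X]
    [MeasurableSpace X] {μ : Measure X} {W : X → EuclideanSpace ℝ ι}
    (hW : LocallyIntegrable W μ) (k : ι) : LocallyIntegrable (fun x => W x k) μ := by
  intro x
  obtain ⟨s, hs, hi⟩ := hW x
  exact ⟨s, hs, (EuclideanSpace.proj k : EuclideanSpace ℝ ι →L[ℝ] ℝ).integrable_comp hi⟩

/-- The support of `K` lies inside `Ω`, so it stays compact in the subtype. Keeping `ψ` separate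
from `K` covers the derivatives of a test function as well. -/
theorem hasCompactSupport_restrict {X : Type*} [TopologicalSpace X]
    {Ω : Set X} {ψ K : X → ℝ} (hK : HasCompactSupport K) (hs : tsupport K ⊆ Ω)
    (h : ∀ x, x ∉ tsupport K → ψ x = 0) [T2Space X] :
    HasCompactSupport (fun x : Ω => ψ x) :=
  HasCompactSupport.intro (Topology.IsInducing.subtypeVal.isCompact_preimage' hK (by simpa using hs))
    fun _ hx => h _ hx

theorem tendsto_integral_apply_mul {X ι : Type*} [Fintype ι] [TopologicalSpace X] [T2Space X]
    [SecondCountableTopology X] [MeasurableSpace X] [OpensMeasurableSpace X] {μ : Measure X}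
    {W : ℕ → X → EuclideanSpace ℝ ι} {Z : X → EuclideanSpace ℝ ι}
    (hW : ∀ m, LocallyIntegrable (W m) μ) (hZ : LocallyIntegrable Z μ)
    (h : Tendsto (fun m => eLpNorm (W m - Z) 1 μ) atTop (𝓝 0)) {ψ : X → ℝ} (hψ : Continuous ψ)
    (hψc : HasCompactSupport ψ) (k : ι) :
    Tendsto (fun m => ∫ x, W m x k * ψ x ∂μ) atTop (𝓝 (∫ x, Z x k * ψ x ∂μ)) := by
  obtain ⟨C, hC⟩ := hψ.bounded_above_of_compact_support hψc
  have hint : ∀ V : X → EuclideanSpace ℝ ι, LocallyIntegrable V μ →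
      Integrable (fun x => V x k * ψ x) μ := fun V hV =>
    (LocallyIntegrable.euclidean_apply hV k).integrable_smul_right_of_hasCompactSupport hψ hψc
  refine tendsto_integral_of_L1' _ (hint Z hZ).aestronglyMeasurable
    (Eventually.of_forall fun m => hint _ (hW m)) ?_
  have h2 : Tendsto (fun m => ENNReal.ofReal C * eLpNorm (W m - Z) 1 μ) atTop (𝓝 0) := by
    have := ENNReal.Tendsto.const_mul h (Or.inr (ENNReal.ofReal_ne_top (r := C)))
    rwa [mul_zero] at this
  refine tendsto_of_tendsto_of_tendsto_of_le_of_le tendsto_const_nhds h2 (fun _ => zero_le) ?_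
  intro m
  refine eLpNorm_le_mul_eLpNorm_of_ae_le_mul (Eventually.of_forall fun x => ?_) 1
  have h3 : ‖(W m x - Z x) k‖ ≤ ‖W m x - Z x‖ := PiLp.norm_apply_le _ k
  calc ‖W m x k * ψ x - Z x k * ψ x‖ = ‖(W m x - Z x) k‖ * ‖ψ x‖ := by
        rw [← norm_mul, PiLp.sub_apply]; congr 1; ring
    _ ≤ ‖W m x - Z x‖ * C := mul_le_mul h3 (hC x) (norm_nonneg _) (norm_nonneg _)
    _ = C * ‖(W m - Z) x‖ := mul_comm _ _

namespace IsTestFunction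

variable {N : ℕ} {Ω : Set (RVec N)} {φ : RVec N → ℝ}

theorem continuous_restrict (h : IsTestFunction Ω φ) : Continuous fun x : Ω => φ x :=
  h.1.continuous.comp continuous_subtype_val

theorem hasCompactSupport_restrict (h : IsTestFunction Ω φ) :
    HasCompactSupport fun x : Ω => φ x :=
  _root_.hasCompactSupport_restrict h.2.1 h.2.2 fun _ hx => image_eq_zero_of_notMem_tsupport hx

theorem continuous_fderiv_restrict (h : IsTestFunction Ω φ) (e : RVec N) :
    Continuous fun x : Ω => fderiv ℝ φ x e :=
  ((h.1.continuous_fderiv (by simp)).clm_apply continuous_const).comp continuous_subtype_val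

theorem hasCompactSupport_fderiv_restrict (h : IsTestFunction Ω φ) (e : RVec N) :
    HasCompactSupport fun x : Ω => fderiv ℝ φ x e := by
  refine _root_.hasCompactSupport_restrict (ψ := fun x => fderiv ℝ φ x e) h.2.1 h.2.2
    fun x hx => ?_
  have : fderiv ℝ φ x = 0 := by
    by_contra h0
    exact hx (support_fderiv_subset ℝ h0)
  simp [this]

end IsTestFunction

namespace HasWeakGradient

variable {N d : ℕ} {Ω : Set (RVec N)}

theorem linear_comb {u v : Ω → RVec d} {U V : Ω → RMat d N}
    (hu : HasWeakGradient Ω u U) (hv : HasWeakGradient Ω v V) (a b : ℝ) :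
    HasWeakGradient Ω (a • u + b • v) (a • U + b • V) := by
  refine ⟨(hu.1.smul a).add (hv.1.smul b), (hu.2.1.smul a).add (hv.2.1.smul b), ?_⟩
  intro φ hφ j i
  have hint : ∀ {ι : Type} [Fintype ι] {W : Ω → EuclideanSpace ℝ ι} {ψ : Ω → ℝ} (k : ι),
      LocallyIntegrable W volume → Continuous ψ → HasCompactSupport ψ →
      Integrable (fun x => W x k * ψ x) volume := fun k hW hψ hψc =>
    (LocallyIntegrable.euclidean_apply hW k).integrable_smul_right_of_hasCompactSupport hψ hψc
  have e1 := hu.2.2 φ hφ j i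
  have e2 := hv.2.2 φ hφ j i
  have c1 := hφ.continuous_fderiv_restrict (EuclideanSpace.single i 1)
  have c2 := hφ.hasCompactSupport_fderiv_restrict (EuclideanSpace.single i 1)
  have c3 := hφ.continuous_restrict
  have c4 := hφ.hasCompactSupport_restrict
  have l1 : ∀ x : Ω, (a • u + b • v) x j * fderiv ℝ φ x (EuclideanSpace.single i 1) =
      a * (u x j * fderiv ℝ φ x (EuclideanSpace.single i 1)) +
        b * (v x j * fderiv ℝ φ x (EuclideanSpace.single i 1)) := by
    intro x
    simp only [Pi.add_apply, Pi.smul_apply, PiLp.add_apply, PiLp.smul_apply, smul_eq_mul]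
    ring
  have l2 : ∀ x : Ω, (a • U + b • V) x (j, i) * φ x =
      a * (U x (j, i) * φ x) + b * (V x (j, i) * φ x) := by
    intro x
    simp only [Pi.add_apply, Pi.smul_apply, PiLp.add_apply, PiLp.smul_apply, smul_eq_mul]
    ring
  simp_rw [l1, l2]
  rw [integral_add ((hint j hu.1 c1 c2).const_mul a) ((hint j hv.1 c1 c2).const_mul b),
    integral_add ((hint (j, i) hu.2.1 c3 c4).const_mul a) ((hint (j, i) hv.2.1 c3 c4).const_mul b)]
  simp_rw [integral_const_mul]
  rw [e1, e2]
  ring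

theorem of_tendsto {v : ℕ → Ω → RVec d} {V : ℕ → Ω → RMat d N} {u : Ω → RVec d}
    {U : Ω → RMat d N} (hv : ∀ m, HasWeakGradient Ω (v m) (V m))
    (hu : LocallyIntegrable u volume) (hU : LocallyIntegrable U volume)
    (h1 : Tendsto (fun m => eLpNorm (v m - u) 1 volume) atTop (𝓝 0))
    (h2 : Tendsto (fun m => eLpNorm (V m - U) 1 volume) atTop (𝓝 0)) :
    HasWeakGradient Ω u U := by
  refine ⟨hu, hU, fun φ hφ j i => ?_⟩
  have t1 := tendsto_integral_apply_mul (fun m => (hv m).1) hu h1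
    (hφ.continuous_fderiv_restrict (EuclideanSpace.single i 1))
    (hφ.hasCompactSupport_fderiv_restrict (EuclideanSpace.single i 1)) j
  have t2 := tendsto_integral_apply_mul (fun m => (hv m).2.1) hU h2
    hφ.continuous_restrict hφ.hasCompactSupport_restrict (j, i)
  refine tendsto_nhds_unique t1 (t2.neg.congr fun m => ?_)
  exact ((hv m).2.2 φ hφ j i).symm

theorem congr_ae {u : Ω → RVec d} {U V : Ω → RMat d N} (hu : HasWeakGradient Ω u U)
    (h : U =ᵐ[volume] V) : HasWeakGradient Ω u V := by
  refine ⟨hu.1, hu.2.1.congr h, fun φ hφ j i => ?_⟩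
  rw [hu.2.2 φ hφ j i]
  congr 1
  refine integral_congr_ae ?_
  filter_upwards [h] with x hx
  rw [hx]

end HasWeakGradient

/-- A sequence converging uniformly whose weak gradients are bounded in `L²` has a weakly
differentiable limit, whose gradient is almost everywhere a limit of convex combinations of tails
of the sequence of gradients. -/
theorem exists_hasWeakGradient_of_bounded {N d : ℕ} {Ω : Set (RVec N)}
    [IsFiniteMeasure (volume : Measure Ω)] {v : ℕ → Ω → RVec d} {V : ℕ → Ω → RMat d N}
    {u : Ω → RVec d} (hu : Integrable u volume) (hv : ∀ k, HasWeakGradient Ω (v k) (V k))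
    {ε : ℕ → ℝ} (hε : Tendsto ε atTop (𝓝 0)) (hvu : ∀ k, ∀ᵐ x, ‖v k x - u x‖ ≤ ε k)
    {C : ℝ≥0∞} (hC : C ≠ ∞) (hV : ∀ k, eLpNorm (V k) 2 volume ≤ C) :
    ∃ U : Ω → RMat d N, HasWeakGradient Ω u U ∧ ∀ᵐ x, ∃ y : ℕ → RMat d N,
      Tendsto y atTop (𝓝 (U x)) ∧
        ∃ᶠ m in atTop, y m ∈ convexHull ℝ ((fun k => V k x) '' Set.Ici m) := by
  have hmem : ∀ k, MemLp (V k) 2 volume := fun k =>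
    ⟨(hv k).2.1.aestronglyMeasurable, (hV k).trans_lt hC.lt_top⟩
  set X : ℕ → Lp (RMat d N) 2 (volume : Measure Ω) := fun k => (hmem k).toLp (V k) with hX
  have hXb : ∀ k, ‖X k‖ ≤ C.toReal := fun k => by
    rw [hX, Lp.norm_toLp]
    exact ENNReal.toReal_mono hC (hV k)
  obtain ⟨Z, Y, hY, hYZ⟩ := exists_tendsto_mem_convexHull_tail X _ hXb
  have hεb : ∀ η > 0, ∃ M, ∀ k ≥ M, ε k ≤ η := fun η hη =>
    eventually_atTop.1 (hε.eventually (ge_mem_nhds hη))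
  -- The property is convex in `W` and holds at each `X k` with `k ≥ m`, so it passes to the hull
  -- without writing coefficients.
  have hprop : ∀ (m : ℕ) (η : ℝ), (∀ k ≥ m, ε k ≤ η) → ∀ W ∈ convexHull ℝ (X '' Set.Ici m),
      (∃ w : Ω → RVec d, HasWeakGradient Ω w W ∧ ∀ᵐ x, ‖w x - u x‖ ≤ η) ∧
        ∀ᵐ x, W x ∈ convexHull ℝ ((fun k => V k x) '' Set.Ici m) := by
    intro m η hη W hW
    refine convexHull_min (t := {W : Lp (RMat d N) 2 (volume : Measure Ω) |
      (∃ w : Ω → RVec d, HasWeakGradient Ω w W ∧ ∀ᵐ x, ‖w x - u x‖ ≤ η) ∧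
        ∀ᵐ x, W x ∈ convexHull ℝ ((fun k => V k x) '' Set.Ici m)}) ?_ ?_ hW
    · rintro _ ⟨k, hk, rfl⟩
      refine ⟨⟨v k, (hv k).congr_ae (hmem k).coeFn_toLp.symm, ?_⟩, ?_⟩
      · filter_upwards [hvu k] with x hx using hx.trans (hη k hk)
      · filter_upwards [(hmem k).coeFn_toLp] with x hx
        rw [hX, hx]
        exact subset_convexHull ℝ _ ⟨k, hk, rfl⟩
    · rintro W₁ ⟨⟨w₁, g₁, b₁⟩, c₁⟩ W₂ ⟨⟨w₂, g₂, b₂⟩, c₂⟩ a b ha hb hab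
      have hco : (a • W₁ + b • W₂ : Lp (RMat d N) 2 (volume : Measure Ω)) =ᵐ[volume]
          a • (W₁ : Ω → RMat d N) + b • (W₂ : Ω → RMat d N) := by
        filter_upwards [Lp.coeFn_add (a • W₁) (b • W₂), Lp.coeFn_smul a W₁, Lp.coeFn_smul b W₂]
          with x h1 h2 h3
        rw [h1, Pi.add_apply, h2, h3, Pi.add_apply]
      refine ⟨⟨a • w₁ + b • w₂, (g₁.linear_comb g₂ a b).congr_ae hco.symm, ?_⟩, ?_⟩
      · filter_upwards [b₁, b₂] with x h1 h2
        have := (convex_closedBall (u x) η) (mem_closedBall_iff_norm.2 h1)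
          (mem_closedBall_iff_norm.2 h2) ha hb hab
        exact mem_closedBall_iff_norm.1 this
      · filter_upwards [c₁, c₂, hco] with x h1 h2 h3
        rw [h3]
        exact convex_convexHull ℝ _ h1 h2 ha hb hab
  -- Only the pointwise half of `hprop` matters here, so any bound `B` of the `ε k` will do.
  have hYhull : ∀ m, ∀ᵐ x, Y m x ∈ convexHull ℝ ((fun k => V k x) '' Set.Ici m) := by
    intro m
    obtain ⟨B, hB⟩ := hε.bddAbove_range
    exact (hprop m B (fun k _ => hB ⟨k, rfl⟩) (Y m) (hY m)).2
  have hYw : ∀ n : ℕ, ∃ m ≥ n, ∃ w : Ω → RVec d, HasWeakGradient Ω w (Y m) ∧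
      ∀ᵐ x, ‖w x - u x‖ ≤ 1 / ((n : ℝ) + 1) := by
    intro n
    obtain ⟨M, hM⟩ := hεb (1 / ((n : ℝ) + 1)) (by positivity)
    exact ⟨max M n, le_max_right _ _, (hprop (max M n) _
      (fun k hk => hM k ((le_max_left _ _).trans hk)) _ (hY _)).1⟩
  choose μ hμ w hw hwu using hYw
  have hμt : Tendsto μ atTop atTop := tendsto_atTop_mono hμ tendsto_id
  have hZi : Integrable Z volume := (Lp.memLp Z).integrable one_le_two
  refine ⟨Z, HasWeakGradient.of_tendsto hw hu.locallyIntegrable hZi.locallyIntegrable ?_ ?_, ?_⟩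
  · have hb : Tendsto (fun n : ℕ => (volume : Measure Ω) Set.univ *
        ENNReal.ofReal (1 / ((n : ℝ) + 1))) atTop (𝓝 0) := by
      have := ENNReal.Tendsto.const_mul (a := (volume : Measure Ω) Set.univ)
        (ENNReal.tendsto_ofReal tendsto_one_div_add_atTop_nhds_zero_nat)
        (Or.inr (measure_ne_top _ _))
      simpa using this
    refine tendsto_of_tendsto_of_tendsto_of_le_of_le tendsto_const_nhds hb (fun _ => zero_le) ?_
    intro n
    have := eLpNorm_le_of_ae_bound (p := 1) (f := w n - u) (hwu n)
    simpa using this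
  · have h2 : Tendsto (fun n => eLpNorm ((Y (μ n) : Ω → RMat d N) - (Z : Ω → RMat d N)) 2 volume *
        (volume : Measure Ω) Set.univ ^ (1 / (1 : ℝ≥0∞).toReal - 1 / (2 : ℝ≥0∞).toReal))
        atTop (𝓝 0) := by
      have h3 := ((Lp.tendsto_Lp_iff_tendsto_eLpNorm' _ _).1 hYZ).comp hμt
      have := ENNReal.Tendsto.mul_const h3 (b := (volume : Measure Ω) Set.univ ^
        (1 / (1 : ℝ≥0∞).toReal - 1 / (2 : ℝ≥0∞).toReal)) (Or.inr
          (ENNReal.rpow_ne_top_of_nonneg (by norm_num) (measure_ne_top _ _)))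
      rwa [zero_mul] at this
    refine tendsto_of_tendsto_of_tendsto_of_le_of_le tendsto_const_nhds h2 (fun _ => zero_le) ?_
    intro n
    exact eLpNorm_le_eLpNorm_mul_rpow_measure_univ one_le_two
      ((Lp.aestronglyMeasurable _).sub (Lp.aestronglyMeasurable _))
  -- Since `ns m ≥ m`, hulls of tails from `ns m` lie in hulls of tails from `m`, so the a.e.
  -- convergent subsequence can be indexed by `m`.
  · obtain ⟨ns, hns, hae⟩ := (tendstoInMeasure_of_tendsto_Lp hYZ).exists_seq_tendsto_ae
    filter_upwards [hae, ae_all_iff.2 hYhull] with x hx hx2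
    refine ⟨fun i => Y (ns i) x, hx, Frequently.of_forall fun m => ?_⟩
    exact convexHull_mono (Set.image_mono (Set.Ici_subset_Ici.2 (hns.id_le m))) (hx2 (ns m))

/-! ### Variable exponents -/

section Exponents

variable {N : ℕ} {Ω : Set (RVec N)} {p : ℕ → Ω → ℝ}

theorem eventually_ae_le_exponent
    (hp_inf : Tendsto (fun n => exponentInf Ω (p n)) atTop (𝓝 ∞)) (K : ℝ) :
    ∀ᶠ n in atTop, ∀ᵐ x, K ≤ p n x := by
  filter_upwards [hp_inf.eventually (lt_mem_nhds (ENNReal.ofReal_lt_top (r := K)))] with n hn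
  filter_upwards [ae_lt_of_lt_essInf hn] with x hx
  exact (ENNReal.ofReal_lt_ofReal_iff'.1 hx).1.le

/-- Unless `Ω` is null, the essential infimum of a real-valued exponent is finite, and the ratio
bound transfers finiteness to the essential supremum. -/
theorem exists_ae_exponent_le {q : Ω → ℝ} {β : ℝ}
    (h : exponentSup Ω q ≤ ENNReal.ofReal β * exponentInf Ω q) : ∃ P : ℝ, ∀ᵐ x, q x ≤ P := by
  rcases eq_or_ne (volume : Measure Ω) 0 with h0 | h0
  · exact ⟨0, by simp [h0]⟩
  have hinf : exponentInf Ω q < ∞ := by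
    rw [lt_top_iff_ne_top]
    intro htop
    have hall : ∀ᵐ x, ∞ ≤ ENNReal.ofReal (q x) := by
      have := ae_essInf_le (μ := (volume : Measure Ω)) (f := fun x => ENNReal.ofReal (q x))
      rw [show essInf (fun x => ENNReal.ofReal (q x)) volume = ∞ from htop] at this
      exact this
    refine h0 (ae_eq_bot.1 (eventually_false_iff_eq_bot.1 ?_))
    filter_upwards [hall] with x hx
    exact ENNReal.ofReal_ne_top (top_le_iff.1 hx)
  have hsup : exponentSup Ω q < ∞ :=
    h.trans_lt (ENNReal.mul_lt_top ENNReal.ofReal_lt_top hinf)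
  refine ⟨(exponentSup Ω q).toReal, ?_⟩
  filter_upwards [ae_le_essSup (μ := (volume : Measure Ω)) (f := fun x => ENNReal.ofReal (q x))]
    with x hx
  exact (ENNReal.ofReal_le_iff_le_toReal hsup.ne).1 hx

end Exponents

/-! ### Modulars and Luxemburg norms for large exponents -/

section Luxemburg

variable {N : ℕ} {Ω : Set (RVec N)}

/-- The strict inequality yields an admissible `s < t`, and the modular decreases as the level
grows; attainment of the infimum is not needed. -/
theorem lintegral_le_one_of_luxemburgNorm_lt {p v : Ω → ℝ} (hp : ∀ x, 0 ≤ p x) {t : ℝ}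
    (h : luxemburgNorm Ω p v < ENNReal.ofReal t) : ∫⁻ x : Ω, ‖v x / t‖ₑ ^ p x ≤ 1 := by
  simp only [luxemburgNorm, iInf_lt_iff] at h
  obtain ⟨s, ⟨hs, hint⟩, hst⟩ := h
  have hst' : s < t := (ENNReal.ofReal_lt_ofReal_iff'.1 hst).1
  refine (lintegral_mono fun x => ?_).trans hint
  refine ENNReal.rpow_le_rpow ?_ (hp x)
  rw [← ofReal_norm, ← ofReal_norm, norm_div, norm_div, Real.norm_of_nonneg hs.le,
    Real.norm_of_nonneg (hs.trans hst').le]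
  exact ENNReal.ofReal_le_ofReal (div_le_div_of_nonneg_left (norm_nonneg _) hs hst'.le)

/-- Functions with small Luxemburg norm for large exponents exceed a larger level only on a small
set. -/
theorem eventually_volume_lt_le {p : ℕ → Ω → ℝ} (hp_meas : ∀ n, AEMeasurable (p n) volume)
    (hp : ∀ n x, 0 ≤ p n x)
    (hp_inf : Tendsto (fun n => exponentInf Ω (p n)) atTop (𝓝 ∞)) {t t' : ℝ} (ht : 0 < t)
    (htt' : t < t') {δ : ℝ≥0∞} (hδ : δ ≠ 0) :
    ∀ᶠ n in atTop, ∀ v : Ω → ℝ, AEMeasurable v volume →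
      luxemburgNorm Ω (p n) v < ENNReal.ofReal t → volume {x | t' < v x} ≤ δ := by
  set c : ℝ≥0∞ := ENNReal.ofReal (t' / t) with hc
  have hc1 : 1 < c := by
    rw [hc, ENNReal.one_lt_ofReal, one_lt_div ht]
    exact htt'
  have hlim := ENNReal.tendsto_rpow_atTop_of_one_lt_base hc1
  -- `K` makes `c ^ K > δ⁻¹`, for Chebyshev's inequality. It depends only on `t`, `t'`, `δ`, so the
  -- threshold on `n` is uniform in `v`.
  obtain ⟨K, hK⟩ := ((hlim.eventually (lt_mem_nhds
    (ENNReal.inv_lt_top.2 (pos_iff_ne_zero.2 hδ)))).and (eventually_ge_atTop 0)).exists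
  filter_upwards [eventually_ae_le_exponent hp_inf K] with n hn v hv hlux
  have hint := lintegral_le_one_of_luxemburgNorm_lt (hp n) hlux
  have hmeas : AEMeasurable (fun x => ‖v x / t‖ₑ ^ p n x) volume :=
    (hv.div_const t).enorm.pow (hp_meas n)
  have hmk := (mul_meas_ge_le_lintegral₀ hmeas (c ^ K)).trans hint
  have hsub : volume {x | t' < v x} ≤ volume {x | c ^ K ≤ ‖v x / t‖ₑ ^ p n x} := by
    refine measure_mono_ae ?_
    filter_upwards [hn] with x hx (hxv : t' < v x)
    have h1 : c ≤ ‖v x / t‖ₑ := by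
      rw [← ofReal_norm, hc]
      refine ENNReal.ofReal_le_ofReal (le_trans ?_ (le_abs_self _))
      gcongr
    exact (ENNReal.rpow_le_rpow_of_exponent_le hc1.le hx).trans (ENNReal.rpow_le_rpow h1 (hp n x))
  have hcK0 : c ^ K ≠ 0 := (lt_of_le_of_lt zero_le hK.1).ne'
  have hcKt : c ^ K ≠ ∞ := ENNReal.rpow_ne_top_of_nonneg hK.2 ENNReal.ofReal_ne_top
  calc volume {x | t' < v x} ≤ (c ^ K)⁻¹ := by
        rw [ENNReal.le_inv_iff_mul_le, mul_comm]
        exact (mul_le_mul_right hsub _).trans hmk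
    _ ≤ δ := ENNReal.inv_le_iff_inv_le.1 hK.1.le

/-- A coercivity bound turns a Luxemburg bound into an `L²` bound. -/
theorem eLpNorm_two_le_of_coercive {E : Type*} [NormedAddCommGroup E] {p v : Ω → ℝ} {V : Ω → E}
    {α γ t : ℝ} (hα : 0 < α) (hγ : 0 < γ) (ht : 0 < t) (hp : ∀ᵐ x, 2 / γ ≤ p x)
    (hV : ∀ᵐ x, α * ‖V x‖ ^ γ ≤ v x) (h : ∫⁻ x : Ω, ‖v x / t‖ₑ ^ p x ≤ 1) :
    eLpNorm V 2 volume ≤ (ENNReal.ofReal (t / α) ^ (2 / γ) *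
      ((volume : Measure Ω) Set.univ + 1)) ^ (1 / (2 : ℝ)) := by
  rw [eLpNorm_eq_lintegral_rpow_enorm_toReal two_ne_zero ENNReal.ofNat_ne_top]
  simp only [ENNReal.toReal_ofNat]
  refine ENNReal.rpow_le_rpow ?_ (by norm_num)
  have hA : ENNReal.ofReal (t / α) ^ (2 / γ) ≠ ∞ :=
    ENNReal.rpow_ne_top_of_nonneg (by positivity) ENNReal.ofReal_ne_top
  calc ∫⁻ x, ‖V x‖ₑ ^ (2 : ℝ)
      ≤ ∫⁻ x, ENNReal.ofReal (t / α) ^ (2 / γ) * (1 + ‖v x / t‖ₑ ^ p x) := by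
        refine lintegral_mono_ae ?_
        filter_upwards [hp, hV] with x hx hVx
        have h1 : ‖V x‖ₑ ^ γ ≤ ENNReal.ofReal (t / α) * ‖v x / t‖ₑ := by
          have hv0 : 0 ≤ v x := le_trans (by positivity) hVx
          rw [← ofReal_norm, ← ofReal_norm, ENNReal.ofReal_rpow_of_nonneg (norm_nonneg _) hγ.le,
            ← ENNReal.ofReal_mul (by positivity), Real.norm_of_nonneg (by positivity)]
          refine ENNReal.ofReal_le_ofReal ?_
          rw [show t / α * (v x / t) = v x / α by field_simp, le_div_iff₀ hα, mul_comm]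
          exact hVx
        -- The summand `1` covers the points where the base is below `1`; elsewhere `2 / γ ≤ p x`
        -- suffices.
        have h2 : ‖v x / t‖ₑ ^ (2 / γ) ≤ 1 + ‖v x / t‖ₑ ^ p x := by
          rcases le_total ‖v x / t‖ₑ 1 with h | h
          · exact (ENNReal.rpow_le_one h (by positivity)).trans le_self_add
          · exact (ENNReal.rpow_le_rpow_of_exponent_le h hx).trans le_add_self
        calc ‖V x‖ₑ ^ (2 : ℝ) = (‖V x‖ₑ ^ γ) ^ (2 / γ) := by
              rw [← ENNReal.rpow_mul, mul_div_cancel₀ _ hγ.ne']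
          _ ≤ (ENNReal.ofReal (t / α) * ‖v x / t‖ₑ) ^ (2 / γ) :=
              ENNReal.rpow_le_rpow h1 (by positivity)
          _ = ENNReal.ofReal (t / α) ^ (2 / γ) * ‖v x / t‖ₑ ^ (2 / γ) :=
              ENNReal.mul_rpow_of_nonneg _ _ (by positivity)
          _ ≤ _ := by gcongr
    _ = ENNReal.ofReal (t / α) ^ (2 / γ) *
          ((volume : Measure Ω) Set.univ + ∫⁻ x, ‖v x / t‖ₑ ^ p x) := by
        rw [lintegral_const_mul' _ _ hA, lintegral_add_left measurable_const, lintegral_const,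
          one_mul]
    _ ≤ _ := by gcongr

/-- Luxemburg norms for exponents tending to infinity are eventually below any level above the
essential supremum. -/
theorem eventually_luxemburgNorm_le [IsFiniteMeasure (volume : Measure Ω)] {p : ℕ → Ω → ℝ}
    (hp : ∀ n x, 0 ≤ p n x)
    (hp_inf : Tendsto (fun n => exponentInf Ω (p n)) atTop (𝓝 ∞)) {v : Ω → ℝ} {m t : ℝ}
    (hv : ∀ᵐ x, |v x| ≤ m) (ht : 0 < t) (hmt : m < t) :
    ∀ᶠ n in atTop, luxemburgNorm Ω (p n) v ≤ ENNReal.ofReal t := by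
  set r : ℝ≥0∞ := ENNReal.ofReal (m / t) with hr
  have hr1 : r < 1 := by
    rw [hr, ENNReal.ofReal_lt_one, div_lt_one ht]
    exact hmt
  have hlim : Tendsto (fun K : ℝ => r ^ K * (volume : Measure Ω) Set.univ) atTop (𝓝 0) := by
    have := ENNReal.Tendsto.mul_const (b := (volume : Measure Ω) Set.univ)
      (ENNReal.tendsto_rpow_atTop_of_base_lt_one hr1) (Or.inr (measure_ne_top _ _))
    rwa [zero_mul] at this
  obtain ⟨K, hK⟩ := (hlim.eventually (ge_mem_nhds zero_lt_one)).exists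
  filter_upwards [eventually_ae_le_exponent hp_inf K] with n hn
  refine iInf₂_le t ⟨ht, (lintegral_mono_ae ?_).trans ((lintegral_const (r ^ K)).trans_le hK)⟩
  filter_upwards [hn, hv] with x hx hvx
  have h1 : ‖v x / t‖ₑ ≤ r := by
    rw [← ofReal_norm, hr, Real.norm_eq_abs, abs_div, abs_of_pos ht]
    exact ENNReal.ofReal_le_ofReal (by gcongr)
  exact (ENNReal.rpow_le_rpow h1 (hp n x)).trans (ENNReal.rpow_le_rpow_of_exponent_ge hr1.le hx)

theorem MemLp.memLpVar [IsFiniteMeasure (volume : Measure Ω)] {E : Type*} [NormedAddCommGroup E]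
    {q : Ω → ℝ} {P : ℝ} (hq : ∀ x, 0 ≤ q x) (hP : ∀ᵐ x, q x ≤ P) {v : Ω → E}
    (hv : MemLp v ∞ volume) : MemLpVar Ω q v := by
  refine ⟨hv.1, ?_⟩
  -- A base at least `1` makes the power increasing in the exponent.
  set B := max 1 (eLpNormEssSup v (volume : Measure Ω)) with hB
  have hBt : B ≠ ∞ := by
    have h := hv.2
    rw [eLpNorm_exponent_top] at h
    exact (max_lt ENNReal.one_lt_top h).ne
  have hbound : ∀ᵐ x, ‖v x‖ₑ ^ q x ≤ B ^ max P 0 := by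
    filter_upwards [hP, ae_le_eLpNormEssSup (f := v)] with x hx hvx
    exact (ENNReal.rpow_le_rpow (hvx.trans (le_max_right _ _)) (hq x)).trans
      (ENNReal.rpow_le_rpow_of_exponent_le (le_max_left _ _) (hx.trans (le_max_left _ _)))
  refine (lintegral_mono_ae hbound).trans_lt ?_
  rw [lintegral_const]
  exact ENNReal.mul_lt_top (ENNReal.rpow_ne_top_of_nonneg (le_max_right _ _) hBt).lt_top
    (measure_lt_top _ _)

end Luxemburg

/-! ### The liminf and limsup inequalities -/

section Functionals

variable {N d : ℕ} {Ω : Set (RVec N)} {f : Ω → RVec d → RMat d N → ℝ}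

/-- Over the Lebesgue σ-algebra, a.e. measurable maps become measurable, so the composition is null
measurable, hence a.e. measurable as a real function. -/
theorem IsNormalIntegrand.aemeasurable_comp (hf : IsNormalIntegrand Ω f) {u : Ω → RVec d}
    {U : Ω → RMat d N} (hu : AEStronglyMeasurable u volume) (hU : AEStronglyMeasurable U volume) :
    AEMeasurable (fun x => f x (u x) (U x)) volume := by
  apply NullMeasurable.aemeasurable
  have h1 : Measurable fun x : NullMeasurableSpace Ω (volume : Measure Ω) => u x :=
    hu.aemeasurable.nullMeasurable
  have h2 : Measurable fun x : NullMeasurableSpace Ω (volume : Measure Ω) => U x :=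
    hU.aemeasurable.nullMeasurable
  have h3 : Measurable fun x : NullMeasurableSpace Ω (volume : Measure Ω) => (x, u x, U x) :=
    measurable_id.prodMk (h1.prodMk h2)
  exact hf.measurable.comp h3

theorem powerFunctional_eq_luxemburgNorm {q : Ω → ℝ} {u : Ω → RVec d} (h : MemW1pVar Ω q u) :
    powerFunctional Ω f q u = luxemburgNorm Ω q (fun x => f x (u x) (weakGrad Ω u x)) :=
  if_pos h

theorem memW1pVar_of_powerFunctional_lt_top {q : Ω → ℝ} {u : Ω → RVec d}
    (h : powerFunctional Ω f q u < ∞) : MemW1pVar Ω q u := by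
  by_contra hcon
  rw [powerFunctional, if_neg hcon] at h
  exact lt_irrefl _ h

theorem norm_le_of_coercive {E : Type*} [NormedAddCommGroup E] {α γ t s : ℝ} (hα : 0 < α)
    (hγ : 0 < γ) {ξ : E} (h : α * ‖ξ‖ ^ γ ≤ s) (hs : s ≤ t) : ‖ξ‖ ≤ (t / α) ^ (1 / γ) := by
  have h1 : ‖ξ‖ ^ γ ≤ t / α := by
    rw [le_div_iff₀ hα, mul_comm]
    exact h.trans hs
  calc ‖ξ‖ = (‖ξ‖ ^ γ) ^ (1 / γ) := by
        rw [← Real.rpow_mul (norm_nonneg _), mul_one_div_cancel hγ.ne', Real.rpow_one]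
    _ ≤ _ := Real.rpow_le_rpow (by positivity) h1 (by positivity)

/-- Formulating convergence as an a.e. bound by `ε n → 0` serves both choices of `X`. -/
theorem supremalFunctional_le_liminf [IsFiniteMeasure (volume : Measure Ω)] (hΩ : IsOpen Ω)
    (hf : IsNormalIntegrand Ω f) (H1 : ∀ᵐ x : Ω, ∀ u : RVec d, LevelConvex (f x u))
    {α γ : ℝ} (hα : 0 < α) (hγ : 0 < γ)
    (H2 : ∀ᵐ x : Ω, ∀ (u : RVec d) (ξ : RMat d N), α * ‖ξ‖ ^ γ ≤ f x u ξ)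
    {p : ℕ → Ω → ℝ} (hp_meas : ∀ n, AEMeasurable (p n) volume) (hp : ∀ n x, 0 ≤ p n x)
    (hp_inf : Tendsto (fun n => exponentInf Ω (p n)) atTop (𝓝 ∞))
    {u : Ω → RVec d} {w : ℕ → Ω → RVec d} (hu : MemLp u ∞ volume) {ε : ℕ → ℝ}
    (hε : Tendsto ε atTop (𝓝 0)) (hwu : ∀ n, ∀ᵐ x, ‖w n x - u x‖ ≤ ε n) :
    supremalFunctional Ω f u ≤ liminf (fun n => powerFunctional Ω f (p n) (w n)) atTop := by
  refine le_of_forall_gt_imp_ge_of_dense fun c hc => ?_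
  rcases eq_or_ne c ∞ with rfl | hct
  · exact le_top
  obtain ⟨t, ht0, hlt, htc⟩ := ENNReal.lt_iff_exists_real_btwn.1 hc
  have ht : 0 < t := ENNReal.ofReal_pos.1 (lt_of_le_of_lt zero_le hlt)
  set t' := c.toReal with ht'
  have hct' : ENNReal.ofReal t' = c := ENNReal.ofReal_toReal hct
  have htt' : t < t' := by
    rw [← hct'] at htc
    exact (ENNReal.ofReal_lt_ofReal_iff'.1 htc).1
  have hfreq : ∃ᶠ n in atTop, powerFunctional Ω f (p n) (w n) < ENNReal.ofReal t :=
    frequently_lt_of_liminf_lt (by isBoundedDefault) hlt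
  -- The measures `2⁻¹ ^ k` are summable, as Borel–Cantelli requires in `hBC`.
  have hδ : ∀ k : ℕ, ((2 : ℝ≥0∞)⁻¹ ^ k) ≠ 0 := fun k => by simp
  obtain ⟨φ, hφ, hP⟩ := extraction_forall_of_frequently fun k =>
    hfreq.and_eventually ((eventually_ae_le_exponent hp_inf (2 / γ)).and
      (eventually_volume_lt_le hp_meas hp hp_inf ht htt' (hδ k)))
  have hmem : ∀ k, MemW1pVar Ω (p (φ k)) (w (φ k)) := fun k =>
    memW1pVar_of_powerFunctional_lt_top ((hP k).1.trans ENNReal.ofReal_lt_top)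
  set V : ℕ → Ω → RMat d N := fun k => weakGrad Ω (w (φ k)) with hV
  have hVg : ∀ k, HasWeakGradient Ω (w (φ k)) (V k) := fun k => (hmem k).1.hasWeakGradient
  have hlux : ∀ k, luxemburgNorm Ω (p (φ k)) (fun x => f x (w (φ k) x) (V k x)) <
      ENNReal.ofReal t := fun k => by
    rw [← powerFunctional_eq_luxemburgNorm (hmem k)]
    exact (hP k).1
  have hV2 : ∀ k, eLpNorm (V k) 2 volume ≤ (ENNReal.ofReal (t / α) ^ (2 / γ) *
      ((volume : Measure Ω) Set.univ + 1)) ^ (1 / (2 : ℝ)) := fun k => by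
    refine eLpNorm_two_le_of_coercive hα hγ ht (hP k).2.1 ?_
      (lintegral_le_one_of_luxemburgNorm_lt (hp _) (hlux k))
    filter_upwards [H2] with x hx using hx _ _
  have hC : (ENNReal.ofReal (t / α) ^ (2 / γ) *
      ((volume : Measure Ω) Set.univ + 1)) ^ (1 / (2 : ℝ)) ≠ ∞ := by
    refine ENNReal.rpow_ne_top_of_nonneg (by norm_num) (ENNReal.mul_ne_top ?_ ?_)
    · exact ENNReal.rpow_ne_top_of_nonneg (by positivity) ENNReal.ofReal_ne_top
    · exact ENNReal.add_ne_top.2 ⟨measure_ne_top _ _, ENNReal.one_ne_top⟩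
  obtain ⟨U, hU, hUlim⟩ := exists_hasWeakGradient_of_bounded (hu.integrable le_top) hVg
    (hε.comp hφ.tendsto_atTop) (fun k => hwu (φ k)) hC hV2
  have hBC : ∀ᵐ x : Ω, ∀ᶠ k in atTop, f x (w (φ k) x) (V k x) ≤ t' := by
    have hsum : ∑' k : ℕ, volume {x : Ω | t' < f x (w (φ k) x) (V k x)} ≠ ∞ := by
      refine ne_top_of_le_ne_top ?_ (ENNReal.tsum_le_tsum fun k => (hP k).2.2 _
        (hf.aemeasurable_comp (hmem k).2.1.1 (hmem k).2.2.1) (hlux k))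
      rw [ENNReal.tsum_geometric, ENNReal.one_sub_inv_two, inv_inv]
      exact ENNReal.ofNat_ne_top
    have h0 := measure_setOfPred_frequently_eq_zero hsum
    rw [ae_iff]
    simpa only [not_eventually, not_le] using h0
  have hle : ∀ᵐ x : Ω, f x (u x) (U x) ≤ t' := by
    filter_upwards [H1, H2, hf.lowerSemicontinuous, hUlim, hBC, ae_all_iff.2 hwu]
      with x h1 h2 hlsc ⟨y, hy, hyc⟩ hbc hx
    refine le_of_tendsto_mem_convexHull_tail hlsc (h1 (u x) t')
      (fun a ξ h => norm_le_of_coercive hα hγ (h2 a ξ) h) ?_ hbc hyc hy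
    rw [tendsto_iff_norm_sub_tendsto_zero]
    exact squeeze_zero (fun _ => norm_nonneg _) (fun k => hx (φ k)) (hε.comp hφ.tendsto_atTop)
  have hwd : WeaklyDifferentiable Ω u := ⟨U, hU⟩
  have hgrad : weakGrad Ω u =ᵐ[volume] U := hwd.hasWeakGradient.ae_eq hΩ hU
  have hle' : ∀ᵐ x : Ω, f x (u x) (weakGrad Ω u x) ≤ t' := by
    filter_upwards [hle, hgrad] with x hx hg
    rwa [hg]
  -- Coercivity turns the bound on `f` into an `L^∞` bound on the gradient.
  have hW : MemW1Infty Ω u := by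
    refine ⟨hwd, hu, memLp_top_of_bound hwd.hasWeakGradient.2.1.aestronglyMeasurable
      ((t' / α) ^ (1 / γ)) ?_⟩
    filter_upwards [hle', H2] with x hx h2 using norm_le_of_coercive hα hγ (h2 _ _) hx
  rw [supremalFunctional, if_pos hW]
  refine essSup_le_of_ae_le _ ?_
  filter_upwards [hle'] with x hx
  rw [← hct']
  exact ENNReal.ofReal_le_ofReal hx

theorem limsup_powerFunctional_le [IsFiniteMeasure (volume : Measure Ω)]
    {α γ : ℝ} (hα : 0 < α)
    (H2 : ∀ᵐ x : Ω, ∀ (u : RVec d) (ξ : RMat d N), α * ‖ξ‖ ^ γ ≤ f x u ξ)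
    {p : ℕ → Ω → ℝ} (hp : ∀ n x, 0 ≤ p n x)
    (hp_inf : Tendsto (fun n => exponentInf Ω (p n)) atTop (𝓝 ∞)) {β : ℝ}
    (hp_sup : ∀ n, exponentSup Ω (p n) ≤ ENNReal.ofReal β * exponentInf Ω (p n))
    (u : Ω → RVec d) :
    limsup (fun n => powerFunctional Ω f (p n) u) atTop ≤ supremalFunctional Ω f u := by
  refine le_of_forall_gt_imp_ge_of_dense fun c hc => ?_
  by_cases hW : MemW1Infty Ω u
  swap
  · rw [supremalFunctional, if_neg hW] at hc
    exact absurd hc not_top_lt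
  rw [supremalFunctional, if_pos hW] at hc
  obtain ⟨t, ht0, hlt, htc⟩ := ENNReal.lt_iff_exists_real_btwn.1 hc
  have ht : 0 < t := ENNReal.ofReal_pos.1 (lt_of_le_of_lt zero_le hlt)
  set M := essSup (fun x => ENNReal.ofReal (f x (u x) (weakGrad Ω u x))) volume with hM
  have hMt : M ≠ ∞ := (hlt.trans ENNReal.ofReal_lt_top).ne
  have hbound : ∀ᵐ x, |f x (u x) (weakGrad Ω u x)| ≤ M.toReal := by
    filter_upwards [H2, ae_le_essSup (μ := (volume : Measure Ω))
      (f := fun x => ENNReal.ofReal (f x (u x) (weakGrad Ω u x)))] with x h2 hx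
    rw [abs_of_nonneg (le_trans (by positivity) (h2 (u x) (weakGrad Ω u x)))]
    exact (ENNReal.ofReal_le_iff_le_toReal hMt).1 hx
  have hmt : M.toReal < t := (ENNReal.lt_ofReal_iff_toReal_lt hMt).1 hlt
  refine limsup_le_of_le (by isBoundedDefault) ?_
  filter_upwards [eventually_luxemburgNorm_le hp hp_inf hbound ht hmt] with n hn
  obtain ⟨P, hPn⟩ := exists_ae_exponent_le (hp_sup n)
  rw [powerFunctional_eq_luxemburgNorm
    ⟨hW.1, MemLp.memLpVar (hp n) hPn hW.2.1, MemLp.memLpVar (hp n) hPn hW.2.2⟩]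
  exact hn.trans htc.le

end Functionals

/-- The constant sequence is a recovery sequence: `h1` applied to it supplies the missing half of
the limit. -/
theorem gammaConverges_of_le_liminf_of_limsup_const_le {X : Type*} [MetricSpace X]
    {Φ : ℕ → X → ℝ≥0∞} {Φ₀ : X → ℝ≥0∞}
    (h1 : ∀ (x : X) (y : ℕ → X), Tendsto y atTop (𝓝 x) →
      Φ₀ x ≤ liminf (fun n => Φ n (y n)) atTop)
    (h2 : ∀ x : X, limsup (fun n => Φ n x) atTop ≤ Φ₀ x) : GammaConverges Φ Φ₀ :=
  ⟨h1, fun x => ⟨fun _ => x, tendsto_const_nhds,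
    tendsto_of_le_liminf_of_limsup_le (h1 x _ tendsto_const_nhds) (h2 x)⟩⟩

theorem mainTheorem2 (N d : ℕ) (hN : 1 ≤ N) (hd : 1 ≤ d)
    (Ω : Set (RVec N)) (hΩ : IsOpen Ω) (hΩb : Bornology.IsBounded Ω)
    (f : Ω → RVec d → RMat d N → ℝ) (hf : IsNormalIntegrand Ω f)
    (H1 : ∀ᵐ x : Ω, ∀ u : RVec d, LevelConvex (f x u))
    (H2 : ∃ α γ : ℝ, 0 < α ∧ 0 < γ ∧
      ∀ᵐ x : Ω, ∀ (u : RVec d) (ξ : RMat d N), α * ‖ξ‖ ^ γ ≤ f x u ξ)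
    (p : ℕ → Ω → ℝ) (hp_meas : ∀ n, AEMeasurable (p n) volume)
    (hp_one : ∀ n x, 1 < p n x)
    (hp_inf : Tendsto (fun n => exponentInf Ω (p n)) atTop (𝓝 ∞))
    (hp_sup : ∃ β : ℝ, 1 < β ∧
      ∀ n, exponentSup Ω (p n) ≤ ENNReal.ofReal β * exponentInf Ω (p n)) :
    -- `X = L^∞(Ω, ℝ^d)`
    ((∀ (u : Lp (RVec d) ∞ (volume : Measure Ω)) (w : ℕ → Lp (RVec d) ∞ (volume : Measure Ω)),
        Tendsto w atTop (𝓝 u) →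
          supremalFunctional Ω f u ≤ liminf (fun n => powerFunctional Ω f (p n) (w n)) atTop) ∧
      (∀ u : Lp (RVec d) ∞ (volume : Measure Ω),
        ∃ w : ℕ → Lp (RVec d) ∞ (volume : Measure Ω), Tendsto w atTop (𝓝 u) ∧
          limsup (fun n => powerFunctional Ω f (p n) (w n)) atTop ≤ supremalFunctional Ω f u) ∧
      GammaConverges
        (fun n (u : Lp (RVec d) ∞ (volume : Measure Ω)) => powerFunctional Ω f (p n) u)
        (fun u => supremalFunctional Ω f u)) ∧
    -- `X = C(Ω, ℝ^d)` with the sup norm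
    ((∀ (u : Ω →ᵇ RVec d) (w : ℕ → Ω →ᵇ RVec d),
        Tendsto w atTop (𝓝 u) →
          supremalFunctional Ω f u ≤ liminf (fun n => powerFunctional Ω f (p n) (w n)) atTop) ∧
      (∀ u : Ω →ᵇ RVec d,
        ∃ w : ℕ → Ω →ᵇ RVec d, Tendsto w atTop (𝓝 u) ∧
          limsup (fun n => powerFunctional Ω f (p n) (w n)) atTop ≤ supremalFunctional Ω f u) ∧
      GammaConverges (fun n (u : Ω →ᵇ RVec d) => powerFunctional Ω f (p n) u)
        (fun u => supremalFunctional Ω f u)) := by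
  obtain ⟨α, γ, hα, hγ, H2⟩ := H2
  obtain ⟨β, -, hp_sup⟩ := hp_sup
  have hp : ∀ n x, 0 ≤ p n x := fun n x => zero_le_one.trans (hp_one n x).le
  have hfin : IsFiniteMeasure (volume : Measure Ω) := by
    refine ⟨?_⟩
    rw [Measure.Subtype.volume_univ hΩ.measurableSet.nullMeasurableSet]
    exact hΩb.measure_lt_top
  have hsup := limsup_powerFunctional_le hα H2 hp hp_inf hp_sup
  have hLp : ∀ (u : Lp (RVec d) ∞ (volume : Measure Ω))
      (w : ℕ → Lp (RVec d) ∞ (volume : Measure Ω)), Tendsto w atTop (𝓝 u) →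
      supremalFunctional Ω f u ≤ liminf (fun n => powerFunctional Ω f (p n) (w n)) atTop := by
    intro u w hw
    refine supremalFunctional_le_liminf hΩ hf H1 hα hγ H2 hp_meas hp hp_inf (Lp.memLp u)
      (tendsto_iff_norm_sub_tendsto_zero.1 hw) fun n => ?_
    filter_upwards [Lp.coeFn_sub (w n) u, ae_le_eLpNormEssSup (f := ⇑(w n - u))] with x hx hn
    rw [hx, ← eLpNorm_exponent_top, ← Lp.enorm_def, ← ofReal_norm, ← ofReal_norm] at hn
    exact (ENNReal.ofReal_le_ofReal_iff (norm_nonneg _)).1 hn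
  have hC : ∀ (u : Ω →ᵇ RVec d) (w : ℕ → Ω →ᵇ RVec d), Tendsto w atTop (𝓝 u) →
      supremalFunctional Ω f u ≤ liminf (fun n => powerFunctional Ω f (p n) (w n)) atTop := by
    intro u w hw
    refine supremalFunctional_le_liminf hΩ hf H1 hα hγ H2 hp_meas hp hp_inf
      (memLp_top_of_bound u.continuous.aestronglyMeasurable ‖u‖
        (Eventually.of_forall u.norm_coe_le_norm))
      (tendsto_iff_norm_sub_tendsto_zero.1 hw) fun n => Eventually.of_forall fun x => ?_
    exact (w n - u).norm_coe_le_norm x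
  exact ⟨⟨hLp, fun u => ⟨fun _ => u, tendsto_const_nhds, hsup u⟩,
      gammaConverges_of_le_liminf_of_limsup_const_le hLp fun u => hsup u⟩,
    ⟨hC, fun u => ⟨fun _ => u, tendsto_const_nhds, hsup u⟩,
      gammaConverges_of_le_liminf_of_limsup_const_le hC fun u => hsup u⟩⟩
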